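/- Let $\mathcal Z\subset\mathbb R^m$ be compact (the set of state-action pairs), let $k:\mathcal Z\times\mathcal Z\to\mathbb R$ be a continuous positive (semi-)definite kernel with $k(z,z)\le 1$ for all $z$, let $\mathcal H_k$ be its reproducing kernel Hilbert space, and let $\phi(z)=k(z,\cdot)\in\mathcal H_k$. For $h\in[H]$ let $\theta^*_h\in\mathcal H_k$ with $\|\theta_h^*\|_{\mathcal H_k}\le \mathscr S$, and let the labeled data set $\mathcal D_1=\{(z_h^\tau,r_h^\tau)\}_{\tau\in[N_1],h\in[H]}$ consist of random points $z_h^\tau\in\mathcal Z$ and rewards $$r_h^\tau=\langle\theta_h^*,\phi(z_h^\tau)\rangle_{\mathcal H_k}+\epsilon_h^\tau ,$$ where the noise $\epsilon_h^\tau$ is centered and $1$-sub-Gaussian, i.e. $\mathbb E\,e^{t\epsilon_h^\tau}\le e^{t^2/2}$ for all $t\in\mathbb R$, and $\epsilon_h^\tau$ is independent of $(z_h^1,\dots,z_h^\tau,\epsilon_h^1,\dots,\epsilon_h^{\tau-1})$. (This holds in particular when, for each $h$, the noise is i.i.d. and independent of the state-action data.) Let $\nu\ge 1$, $\delta\in(0,1)$,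 and let $$\widehat\theta_h=\operatorname*{arg\,min}_{\theta\in\mathcal H_k}\ \sum_{\tau=1}^{N_1}\bigl[r_h^\tau-\langle\phi(z_h^\tau),\theta\rangle_{\mathcal H_k}\bigr]^2+\nu\|\theta\|_{\mathcal H_k}^2 .$$ Put $\Lambda_h^{\mathcal D_1}=\sum_{\tau=1}^{N_1}\phi(z_h^\tau)\phi(z_h^\tau)^\top+\nu I_{\mathcal H_k}$, $\|\theta\|_{\Lambda_h^{\mathcal D_1}}^2=\langle\theta,\Lambda_h^{\mathcal D_1}\theta\rangle_{\mathcal H_k}$, $[K_h^{\mathcal D_1}]_{\tau,\tau'}=k(z_h^\tau,z_h^{\tau'})$ and $$\beta_h(\delta)=\sqrt\nu\,\mathscr S+\sqrt{\log\frac{\det[\nu I+K_h^{\mathcal D_1}]}{\delta^2}} .$$ Then for every $h\in[H]$, with probability at least $1-\delta$, $$\|\widehat\theta_h-\theta_h^*\|_{\Lambda_h^{\mathcal D_1}}\le\beta_h(\delta);$$ equivalently, $\mathbb P(\theta_h^*\in\mathcal C_h(\delta))\ge1-\delta$ for the ellipsoid $\mathcal C_h(\delta)=\{\theta\in\mathcal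 H_k:\|\theta-\widehat\theta_h\|_{\Lambda_h^{\mathcal D_1}}\le\beta_h(\delta)\}$. Furthermore, let $G(n,\lambda)=\sup\{\tfrac12\log\det(I+K_{\mathcal D}/\lambda)\}$ be the maximum information gain, where the supremum is over all data sets $\mathcal D$ of at most $n$ points of $\mathcal Z$ (finite sequences, repeated points being allowed and counted with multiplicity) and $K_{\mathcal D}$ is the Gram matrix of $\mathcal D$. If $N_1\ge1$ and $\nu=1+1/N_1$, then always $$\beta_h(\delta)\le\bar\beta_h(\delta):=\sqrt\nu\,\mathscr S+\sqrt{2G(N_1,\nu)+1+\log\frac1{\delta^2}},$$ and the bound $\|\widehat\theta_h-\theta_h^*\|_{\Lambda_h^{\mathcal D_1}}\le\bar\beta_h(\delta)$ and the statement $\mathbb P(\theta_h^*\in\mathcal C_h(\delta))\ge1-\delta$ also hold with $\bar\beta_h(\delta)$ as the radius. -/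

import Mathlib

open MeasureTheory ProbabilityTheory

noncomputable section

namespace KernelRidge

/-- The Gram matrix `K i j = k (z i) (z j)` of a finite family of points. -/
def gramMatrix {X ι : Type*} (k : X → X → ℝ) (z : ι → X) : Matrix ι ι ℝ :=
  Matrix.of fun i j => k (z i) (z j)

/-- The maximum information gain
`G(n, lam) = sup { (1/2) log det (I + K_D / lam) : D a dataset in X, |D| ≤ n }`.
A dataset is a finite sequence of points of `X`, so repeated points are allowed and are counted
with their multiplicity. -/
def maxInfoGain {X : Type*} (k : X → X → ℝ) (n : ℕ) (lam : ℝ) : ℝ :=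
  sSup {g : ℝ | ∃ l : ℕ, l ≤ n ∧ ∃ z : Fin l → X,
    g = (1 / 2) * Real.log (1 + lam⁻¹ • gramMatrix k z).det}

section RKHS

variable {X E : Type*} [NormedAddCommGroup E] [InnerProductSpace ℝ E] [CompleteSpace E]
  [RKHS ℝ E X ℝ]

/-- The real-valued reproducing kernel of a reproducing kernel Hilbert space of real functions
(the kernel of Mathlib has values in the operators on `ℝ`; evaluate these at `1`). -/
def reproducingKernel (E : Type*) {X : Type*} [NormedAddCommGroup E] [InnerProductSpace ℝ E]
    [CompleteSpace E] [RKHS ℝ E X ℝ] (x y : X) : ℝ :=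
  RKHS.kernel E x y 1

/-- The feature map `φ x = k(x, ·)`, an element of the reproducing kernel Hilbert space `E`. -/
def feature (E : Type*) {X : Type*} [NormedAddCommGroup E] [InnerProductSpace ℝ E]
    [CompleteSpace E] [RKHS ℝ E X ℝ] (x : X) : E :=
  RKHS.kerFun E x 1

/-- The objective of kernel ridge regression,
`∑ τ, (y τ - ⟪φ (z τ), θ⟫) ^ 2 + nu * ‖θ‖ ^ 2`. -/
def ridgeObjective {N : ℕ} (z : Fin N → X) (y : Fin N → ℝ) (nu : ℝ) (θ : E) : ℝ :=
  (∑ τ, (y τ - inner ℝ (feature E (z τ)) θ) ^ 2) + nu * ‖θ‖ ^ 2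

/-- The operator `Λ = ∑ τ, φ (z τ) φ (z τ)ᵀ + nu I` on `E`. -/
def covOp (E : Type*) {X : Type*} [NormedAddCommGroup E] [InnerProductSpace ℝ E]
    [CompleteSpace E] [RKHS ℝ E X ℝ] {N : ℕ} (z : Fin N → X) (nu : ℝ) : E →L[ℝ] E :=
  (∑ τ, InnerProductSpace.rankOne ℝ (feature E (z τ)) (feature E (z τ)))
    + nu • ContinuousLinearMap.id ℝ E

end RKHS

/-- The weighted norm `‖θ‖_Λ = √⟪θ, Λ θ⟫`. -/
def weightedNorm {E : Type*} [NormedAddCommGroup E] [InnerProductSpace ℝ E]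
    (L : E →L[ℝ] E) (θ : E) : ℝ :=
  Real.sqrt (inner ℝ θ (L θ))

/-- The ellipsoid `{θ | ‖θ - c‖_Λ ≤ r}`. -/
def ellipsoid {E : Type*} [NormedAddCommGroup E] [InnerProductSpace ℝ E]
    (L : E →L[ℝ] E) (c : E) (r : ℝ) : Set E :=
  {θ | weightedNorm L (θ - c) ≤ r}

/-- The radius `√nu * S + √(log (det (nu I + K) / δ ^ 2))`, with `K` the Gram matrix of `z`. -/
def radius {X : Type*} (k : X → X → ℝ) {N : ℕ} (z : Fin N → X) (nu S δ : ℝ) : ℝ :=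
  Real.sqrt nu * S + Real.sqrt (Real.log
    ((nu • (1 : Matrix (Fin N) (Fin N) ℝ) + gramMatrix k z).det / δ ^ 2))

/-- The radius in terms of the information gain,
`√nu * S + √(2 G(N, nu) + 1 + log (1 / δ ^ 2))`. -/
def gainRadius {X : Type*} (k : X → X → ℝ) (N : ℕ) (nu S δ : ℝ) : ℝ :=
  Real.sqrt nu * S + Real.sqrt (2 * maxInfoGain k N nu + 1 + Real.log (1 / δ ^ 2))

end KernelRidge

end

/-! The argument is the method of mixtures in finite dimensions. Write `A = nu I + K` and let `e` be
the noise vector. The quantity `evidenceRatio` is the density at `e` of N(0, A) divided by that of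
N(0, I).

Probability: for points `z` chosen adaptively, this ratio has expectation at most 1
(`lintegral_evidenceRatio_le_one`). Appending one observation multiplies it by the density ratio of
N(μ, s) to N(0, 1) at the new noise value, where μ is a predictive mean and `s` a Schur complement.
Since `s ≥ nu ≥ 1`, this factor is a mixture of the functions exp(l t - l²/2) over l ~ N(μ, s - 1),
and each of these has mean at most 1 by sub-Gaussianity. Markov's inequality then bounds the ratio
by 1/δ with probability at least 1 - δ.

Algebra: for every outcome the error obeys Λ(θ - θ₀) = ∑ e_τ φ(z_τ) - nu θ₀. Cauchy–Schwarz in the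
Λ-norm bounds it by √nu ‖θ₀‖ + √(eᵀe - eᵀA⁻¹e) (`weightedNorm_sub_le`). The second radicand is twice
the exponent in `evidenceRatio`, so the event above bounds it by log(det A / δ²).

The information-gain radius follows from det A = nu^N det(I + K/nu) and N log nu ≤ N(nu - 1) = 1. -/

namespace KernelRidge

/-! ### Gaussian mixtures of exponential supermartingale factors -/

section Gaussian

open scoped NNReal

/-- As exp(l t - l²/2) is the density ratio of N(l, 1) to N(0, 1) at `t`, mixing over l ~ N(μ, v)
yields that of N(μ, 1 + v). -/
lemma lintegral_exp_gaussianReal (μ : ℝ) (v : ℝ≥0) (t : ℝ) :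
    ∫⁻ l, ENNReal.ofReal (Real.exp (l * t - l ^ 2 / 2)) ∂gaussianReal μ v =
      ENNReal.ofReal
        (Real.exp ((t ^ 2 - (t - μ) ^ 2 / (1 + v)) / 2) / Real.sqrt (1 + v)) := by
  by_cases hv : v = 0
  · subst hv
    rw [gaussianReal_zero_var, lintegral_dirac]
    congr 1
    simp only [NNReal.coe_zero, add_zero, Real.sqrt_one, div_one]
    congr 1
    ring
  have hv0 : (0 : ℝ) < v := by positivity
  have hw : v / (1 + v) ≠ 0 := by positivity
  rw [gaussianReal_of_var_ne_zero _ hv, lintegral_withDensity_eq_lintegral_mul _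
    (measurable_gaussianPDF μ v) (by fun_prop)]
  -- Completing the square in `l` leaves the Gaussian posterior density of `l` given `t`, which
  -- integrates to 1.
  have key : ∀ l, (gaussianPDF μ v * fun l => ENNReal.ofReal (Real.exp (l * t - l ^ 2 / 2))) l =
      ENNReal.ofReal (Real.exp ((t ^ 2 - (t - μ) ^ 2 / (1 + v)) / 2) / Real.sqrt (1 + v)) *
        ENNReal.ofReal (gaussianPDFReal ((μ + v * t) / (1 + v)) (v / (1 + v)) l) := by
    intro l
    rw [Pi.mul_apply, gaussianPDF, ← ENNReal.ofReal_mul (gaussianPDFReal_nonneg _ _ _),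
      ← ENNReal.ofReal_mul (by positivity)]
    congr 1
    simp only [gaussianPDFReal, NNReal.coe_div, NNReal.coe_add, NNReal.coe_one]
    have hs : Real.sqrt (2 * Real.pi * v) =
        Real.sqrt (1 + v) * Real.sqrt (2 * Real.pi * (v / (1 + v))) := by
      rw [← Real.sqrt_mul (by positivity)]
      congr 1
      field_simp
    have h1 : 0 < Real.sqrt (1 + (v : ℝ)) := by positivity
    have h2 : 0 < Real.sqrt (2 * Real.pi * (v / (1 + v))) := by positivity
    rw [hs, mul_assoc, ← Real.exp_add, div_mul_eq_mul_div, mul_left_comm, ← Real.exp_add,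
      mul_inv, mul_assoc, inv_mul_eq_div]
    congr 3
    field_simp
    ring
  rw [lintegral_congr key, lintegral_const_mul _ (by fun_prop),
    lintegral_gaussianPDFReal_eq_one _ hw, mul_one]

lemma lintegral_exp_sub_sq_le_one {Ω : Type*} [MeasurableSpace Ω] {P : Measure Ω}
    [IsProbabilityMeasure P] {X : Ω → ℝ} (hX : Measurable X) (hsub : HasSubgaussianMGF X 1 P)
    (μ s : ℝ) (hs : 1 ≤ s) :
    ∫⁻ ω, ENNReal.ofReal
      (Real.exp ((X ω ^ 2 - (X ω - μ) ^ 2 / s) / 2) / Real.sqrt s) ∂P ≤ 1 := by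
  -- The mixing law has variance `s - 1`, which is where `1 ≤ s` enters; `s = 1` gives a Dirac mass.
  have hsv : s = 1 + ((s - 1).toNNReal : ℝ) := by
    rw [Real.coe_toNNReal _ (by linarith)]; ring
  rw [hsv]
  simp_rw [← lintegral_exp_gaussianReal]
  rw [lintegral_lintegral_swap (by fun_prop)]
  calc _ ≤ ∫⁻ _, 1 ∂gaussianReal μ (s - 1).toNNReal := by
        refine lintegral_mono fun l => ?_
        have hint : Integrable (fun ω => Real.exp (l * X ω - l ^ 2 / 2)) P := by
          simpa only [Real.exp_sub] using (hsub.integrable_exp_mul l).div_const _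
        rw [← ofReal_integral_eq_lintegral_ofReal hint
          (Filter.Eventually.of_forall fun _ => (Real.exp_pos _).le), ← ENNReal.ofReal_one]
        refine ENNReal.ofReal_le_ofReal ?_
        have hm := hsub.mgf_le l
        simp only [mgf, NNReal.coe_one, one_mul] at hm
        simp only [Real.exp_sub, integral_div]
        exact (div_le_one (Real.exp_pos _)).2 hm
    _ = 1 := by simp

end Gaussian

/-! ### Determinant and inverse quadratic form of a bordered matrix -/

section Bordered

open Matrix

variable {n : ℕ} {M : Matrix (Fin (n + 1)) (Fin (n + 1)) ℝ} {A : Matrix (Fin n) (Fin n) ℝ}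
  {b : Fin n → ℝ}

lemma det_eq_mul_schur (hA : A = M.submatrix Fin.castSucc Fin.castSucc) (hdet : A.det ≠ 0)
    (hb : ∀ i, M i.castSucc (Fin.last n) = b i) (hb' : ∀ i, M (Fin.last n) i.castSucc = b i) :
    M.det = A.det * (M (Fin.last n) (Fin.last n) - b ⬝ᵥ A⁻¹ *ᵥ b) := by
  have hblock : M.submatrix finSumFinEquiv finSumFinEquiv =
      fromBlocks A (replicateCol (Fin 1) b) (replicateRow (Fin 1) b)
        (of fun _ _ => M (Fin.last n) (Fin.last n)) := by
    subst hA
    ext (i | i) (j | j)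
    · rfl
    · rw [Subsingleton.elim j 0]; exact hb i
    · rw [Subsingleton.elim i 0]; exact hb' j
    · rw [Subsingleton.elim i 0, Subsingleton.elim j 0]; rfl
  have := invertibleOfIsUnitDet A (isUnit_iff_ne_zero.2 hdet)
  rw [← det_submatrix_equiv_self finSumFinEquiv M, hblock, det_fromBlocks₁₁, det_fin_one]
  congr 1
  rw [invOf_eq_nonsing_inv, Matrix.mul_assoc, ← replicateCol_mulVec]
  simp [Matrix.mul_apply, dotProduct]

lemma quadForm_inv_snoc (hA : A = M.submatrix Fin.castSucc Fin.castSucc) (hdet : A.det ≠ 0)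
    (hsymm : A.IsSymm)
    (hb : ∀ i, M i.castSucc (Fin.last n) = b i) (hb' : ∀ i, M (Fin.last n) i.castSucc = b i)
    {s : ℝ} (hs : s = M (Fin.last n) (Fin.last n) - b ⬝ᵥ A⁻¹ *ᵥ b) (hs0 : s ≠ 0)
    (e : Fin n → ℝ) (t : ℝ) :
    (Fin.snoc e t : Fin (n + 1) → ℝ) ⬝ᵥ M⁻¹ *ᵥ (Fin.snoc e t : Fin (n + 1) → ℝ) =
      e ⬝ᵥ A⁻¹ *ᵥ e + (t - b ⬝ᵥ A⁻¹ *ᵥ e) ^ 2 / s := by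
  have hMdet : IsUnit M.det := by
    rw [det_eq_mul_schur hA hdet hb hb', ← hs]
    exact isUnit_iff_ne_zero.2 (mul_ne_zero hdet hs0)
  have hAA : ∀ x : Fin n → ℝ, A *ᵥ A⁻¹ *ᵥ x = x := fun x => by
    rw [mulVec_mulVec, mul_nonsing_inv _ (isUnit_iff_ne_zero.2 hdet), one_mulVec]
  have hswap : e ⬝ᵥ A⁻¹ *ᵥ b = b ⬝ᵥ A⁻¹ *ᵥ e := by
    rw [dotProduct_mulVec, ← mulVec_transpose, transpose_nonsing_inv, hsymm.eq,
      dotProduct_comm]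
  set q : ℝ := (t - b ⬝ᵥ A⁻¹ *ᵥ e) / s with hq
  -- Block elimination: `(w, q)` solves `M x = (e, t)`, with `q` the residual of `t` divided by the
  -- Schur complement.
  set w : Fin n → ℝ := A⁻¹ *ᵥ e - q • A⁻¹ *ᵥ b with hw
  have hMw : M *ᵥ (Fin.snoc w q : Fin (n + 1) → ℝ) = Fin.snoc e t := by
    have hAw : A *ᵥ w = e - q • b := by
      rw [hw, mulVec_sub, mulVec_smul, hAA, hAA]
    have hbw : b ⬝ᵥ w = b ⬝ᵥ A⁻¹ *ᵥ e - q * (b ⬝ᵥ A⁻¹ *ᵥ b) := by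
      rw [hw, dotProduct_sub, dotProduct_smul, smul_eq_mul]
    funext i
    refine Fin.lastCases ?_ (fun i => ?_) i
    · simp only [mulVec, dotProduct, Fin.sum_univ_castSucc, Fin.snoc_castSucc, Fin.snoc_last,
        hb']
      change b ⬝ᵥ w + _ = t
      rw [hbw]
      have : q * s = t - b ⬝ᵥ A⁻¹ *ᵥ e := by rw [hq]; field_simp
      rw [hs] at this
      linarith
    · simp only [mulVec, dotProduct, Fin.sum_univ_castSucc, Fin.snoc_castSucc, Fin.snoc_last,
        hb]
      have h := congrFun hAw i
      rw [hA] at h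
      simp only [mulVec, dotProduct, submatrix_apply, Pi.sub_apply, Pi.smul_apply,
        smul_eq_mul] at h
      rw [h]
      ring
  have hinv : M⁻¹ *ᵥ (Fin.snoc e t : Fin (n + 1) → ℝ) = Fin.snoc w q := by
    rw [← hMw, mulVec_mulVec, nonsing_inv_mul _ hMdet, one_mulVec]
  rw [hinv]
  have hsum : (Fin.snoc e t : Fin (n + 1) → ℝ) ⬝ᵥ (Fin.snoc w q : Fin (n + 1) → ℝ) =
      e ⬝ᵥ w + t * q := by
    simp [dotProduct, Fin.sum_univ_castSucc]
  rw [hsum, hw, dotProduct_sub, dotProduct_smul, smul_eq_mul, hswap, hq]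
  field_simp
  ring

end Bordered

end KernelRidge

namespace KernelRidge

/-! ### The evidence ratio has expectation at most one -/

section Evidence

open Matrix

variable {X : Type*} {k : X → X → ℝ} {nu : ℝ} {n : ℕ}

/-- The regularized Gram matrix `nu I + K`. -/
noncomputable def regGram {X : Type*} (k : X → X → ℝ) (nu : ℝ) {n : ℕ} (z : Fin n → X) :
    Matrix (Fin n) (Fin n) ℝ :=
  nu • (1 : Matrix (Fin n) (Fin n) ℝ) + gramMatrix k z

/-- The likelihood ratio of a centered Gaussian vector of covariance `nu I + K` against a standard
Gaussian vector, at the noise vector `e`. -/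
noncomputable def evidenceRatio {X : Type*} (k : X → X → ℝ) (nu : ℝ) {n : ℕ} (z : Fin n → X)
    (e : Fin n → ℝ) : ℝ :=
  Real.exp ((e ⬝ᵥ e - e ⬝ᵥ (regGram k nu z)⁻¹ *ᵥ e) / 2) / Real.sqrt (regGram k nu z).det

lemma posDef_regGram (hk : ∀ (n : ℕ) (z : Fin n → X), (gramMatrix k z).PosSemidef)
    (hnu : 0 < nu) (z : Fin n → X) : (regGram k nu z).PosDef :=
  (PosDef.one.smul hnu).add_posSemidef (hk n z)

/-- The vector `w = (-A⁻¹b, 1)` is mapped by the full matrix to `(0, s)`, so `s` is the quadratic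
form at `w`. This is at least `nu * |w|² ≥ nu`, because the Gram part is positive semidefinite. -/
lemma le_schur_regGram (hk : ∀ (n : ℕ) (z : Fin n → X), (gramMatrix k z).PosSemidef)
    (hnu : 0 < nu) (z : Fin (n + 1) → X) (b : Fin n → ℝ)
    (hb : ∀ i, regGram k nu z i.castSucc (Fin.last n) = b i)
    (hb' : ∀ i, regGram k nu z (Fin.last n) i.castSucc = b i) :
    nu ≤ regGram k nu z (Fin.last n) (Fin.last n) -
      b ⬝ᵥ (regGram k nu (z ∘ Fin.castSucc))⁻¹ *ᵥ b := by
  set A := regGram k nu (z ∘ Fin.castSucc) with hA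
  set s := regGram k nu z (Fin.last n) (Fin.last n) - b ⬝ᵥ A⁻¹ *ᵥ b with hs
  have hdet : A.det ≠ 0 := (posDef_regGram hk hnu _).det_pos.ne'
  set w : Fin (n + 1) → ℝ := Fin.snoc (-(A⁻¹ *ᵥ b)) 1 with hw
  have hAA : A *ᵥ A⁻¹ *ᵥ b = b := by
    rw [mulVec_mulVec, mul_nonsing_inv _ (isUnit_iff_ne_zero.2 hdet), one_mulVec]
  have hMw : regGram k nu z *ᵥ w = Fin.snoc 0 s := by
    funext i
    refine Fin.lastCases ?_ (fun i => ?_) i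
    · simp only [mulVec, dotProduct, Fin.sum_univ_castSucc, hw, Fin.snoc_castSucc, Fin.snoc_last,
        hb']
      change b ⬝ᵥ (-(A⁻¹ *ᵥ b)) + _ = s
      rw [dotProduct_neg, hs]
      ring
    · simp only [mulVec, dotProduct, Fin.sum_univ_castSucc, hw, Fin.snoc_castSucc, Fin.snoc_last,
        hb]
      have h : A i ⬝ᵥ (-(A⁻¹ *ᵥ b)) = - b i := by
        rw [dotProduct_neg]; exact congrArg Neg.neg (congrFun hAA i)
      have h2 : ∀ j, regGram k nu z i.castSucc j.castSucc = A i j := fun j => by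
        simp [hA, regGram, gramMatrix, Matrix.one_apply]
      simp only [h2]
      change A i ⬝ᵥ (-(A⁻¹ *ᵥ b)) + _ = _
      rw [h]
      simp
  have h1 : w ⬝ᵥ regGram k nu z *ᵥ w = s := by
    rw [hMw]
    simp [dotProduct, Fin.sum_univ_castSucc, hw]
  have h2 : w ⬝ᵥ regGram k nu z *ᵥ w = nu * (w ⬝ᵥ w) + w ⬝ᵥ gramMatrix k z *ᵥ w := by
    rw [regGram, add_mulVec, dotProduct_add, smul_mulVec, one_mulVec, dotProduct_smul,
      smul_eq_mul]
  have h3 : 0 ≤ w ⬝ᵥ gramMatrix k z *ᵥ w := by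
    simpa using (hk _ z).dotProduct_mulVec_nonneg w
  have h4 : 1 ≤ w ⬝ᵥ w := by
    simp only [dotProduct, Fin.sum_univ_castSucc, hw, Fin.snoc_castSucc, Fin.snoc_last, mul_one]
    have : 0 ≤ ∑ i, (-(A⁻¹ *ᵥ b)) i * (-(A⁻¹ *ᵥ b)) i :=
      Finset.sum_nonneg fun i _ => mul_self_nonneg _
    linarith
  nlinarith

lemma exists_evidenceRatio_snoc (hk : ∀ (n : ℕ) (z : Fin n → X), (gramMatrix k z).PosSemidef)
    (hnu : 1 ≤ nu) (z : Fin (n + 1) → X) (e : Fin n → ℝ) :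
    ∃ μ s : ℝ, 1 ≤ s ∧ ∀ t : ℝ, evidenceRatio k nu z (Fin.snoc e t) =
      evidenceRatio k nu (z ∘ Fin.castSucc) e *
        (Real.exp ((t ^ 2 - (t - μ) ^ 2 / s) / 2) / Real.sqrt s) := by
  have hnu0 : 0 < nu := by linarith
  have hMpos := posDef_regGram hk hnu0 z
  have hApos := posDef_regGram hk hnu0 (z ∘ Fin.castSucc)
  have hA : regGram k nu (z ∘ Fin.castSucc) =
      (regGram k nu z).submatrix Fin.castSucc Fin.castSucc := by
    ext i j
    simp [regGram, gramMatrix, Matrix.one_apply]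
  set b : Fin n → ℝ := fun i => regGram k nu z i.castSucc (Fin.last n) with hbdef
  have hb : ∀ i, regGram k nu z i.castSucc (Fin.last n) = b i := fun _ => rfl
  have hb' : ∀ i, regGram k nu z (Fin.last n) i.castSucc = b i := fun i => by
    simpa using (hMpos.isHermitian.apply (Fin.last n) i.castSucc).symm
  have hsle := le_schur_regGram hk hnu0 z b hb hb'
  refine ⟨b ⬝ᵥ (regGram k nu (z ∘ Fin.castSucc))⁻¹ *ᵥ e, _, hnu.trans hsle, fun t => ?_⟩
  have hsymm : (regGram k nu (z ∘ Fin.castSucc)).IsSymm := by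
    simpa [IsHermitian, IsSymm] using hApos.isHermitian
  rw [evidenceRatio, evidenceRatio, det_eq_mul_schur hA hApos.det_pos.ne' hb hb',
    quadForm_inv_snoc hA hApos.det_pos.ne' hsymm hb hb' rfl (by linarith) e t,
    Real.sqrt_mul hApos.det_pos.le, div_mul_div_comm, ← Real.exp_add]
  congr 2
  have : (Fin.snoc e t : Fin (n + 1) → ℝ) ⬝ᵥ (Fin.snoc e t : Fin (n + 1) → ℝ) =
      e ⬝ᵥ e + t ^ 2 := by
    simp [dotProduct, Fin.sum_univ_castSucc, sq]
  rw [this]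
  ring

lemma measurable_evidenceRatio [TopologicalSpace X] [SecondCountableTopology X]
    [MeasurableSpace X] [BorelSpace X] (hk : Continuous fun p : X × X => k p.1 p.2)
    (nu : ℝ) (n : ℕ) :
    Measurable fun p : (Fin n → X) × (Fin n → ℝ) => evidenceRatio k nu p.1 p.2 := by
  have hcont : Continuous fun p : (Fin n → X) × (Fin n → ℝ) => regGram k nu p.1 := by
    refine continuous_matrix fun i j => ?_
    simp only [regGram, gramMatrix, Matrix.add_apply, Matrix.smul_apply, Matrix.of_apply]
    have hij : Continuous fun p : (Fin n → X) × (Fin n → ℝ) => (p.1 i, p.1 j) := by fun_prop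
    exact continuous_const.add (hk.comp hij)
  have hdet : Measurable fun p : (Fin n → X) × (Fin n → ℝ) => (regGram k nu p.1).det :=
    hcont.matrix_det.measurable
  have hquad : Measurable fun p : (Fin n → X) × (Fin n → ℝ) =>
      p.2 ⬝ᵥ (regGram k nu p.1).adjugate *ᵥ p.2 :=
    (continuous_snd.dotProduct (hcont.matrix_adjugate.matrix_mulVec continuous_snd)).measurable
  have hsq : Measurable fun p : (Fin n → X) × (Fin n → ℝ) => p.2 ⬝ᵥ p.2 :=
    (continuous_snd.dotProduct continuous_snd).measurable
  -- Writing the inverse as adjugate over determinant reduces measurability to expressions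
  -- continuous in the data.
  simp only [evidenceRatio, Matrix.inv_def, Ring.inverse_eq_inv', smul_mulVec, dotProduct_smul,
    smul_eq_mul]
  fun_prop

lemma lintegral_evidenceRatio_le_one [TopologicalSpace X] [SecondCountableTopology X]
    [MeasurableSpace X] [BorelSpace X] (hk_cont : Continuous fun p : X × X => k p.1 p.2)
    (hk : ∀ (n : ℕ) (z : Fin n → X), (gramMatrix k z).PosSemidef) (hnu : 1 ≤ nu)
    {Ω : Type*} [MeasurableSpace Ω] {P : Measure Ω} [IsProbabilityMeasure P] {N : ℕ}
    {z : Fin N → Ω → X} (hz : ∀ τ, Measurable (z τ))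
    {ε : Fin N → Ω → ℝ} (hε : ∀ τ, Measurable (ε τ))
    (hε_subG : ∀ τ, HasSubgaussianMGF (ε τ) 1 P)
    (hε_indep : ∀ τ, IndepFun (ε τ)
      (fun ω => ((fun i : Set.Iic τ => z i ω), (fun i : Set.Iio τ => ε i ω))) P)
    (n : ℕ) (hn : n ≤ N) :
    ∫⁻ ω, ENNReal.ofReal (evidenceRatio k nu (fun i : Fin n => z (i.castLE hn) ω)
      (fun i => ε (i.castLE hn) ω)) ∂P ≤ 1 := by
  induction n with
  | zero => simp [evidenceRatio]
  | succ n ih =>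
    have hn' : n ≤ N := by omega
    let τ : Fin N := ⟨n, hn⟩
    let past : Ω → (Fin (n + 1) → X) × (Fin n → ℝ) := fun ω =>
      (fun i => z (i.castLE hn) ω, fun i => ε (i.castLE hn') ω)
    have hpast : Measurable past := by
      refine Measurable.prodMk ?_ ?_
      · exact measurable_pi_lambda _ fun i => hz _
      · exact measurable_pi_lambda _ fun i => hε _
    -- The past holds `n + 1` points but only `n` noises: the new point may depend on earlier noise,
    -- and the new noise is independent of both.
    let sel : (Set.Iic τ → X) × (Set.Iio τ → ℝ) → (Fin (n + 1) → X) × (Fin n → ℝ) := fun p =>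
      (fun i => p.1 ⟨i.castLE hn, Fin.le_def.2 (Nat.lt_succ_iff.1 i.2)⟩,
        fun i => p.2 ⟨i.castLE hn', Fin.lt_def.2 i.2⟩)
    have hsel : Measurable sel := by
      refine Measurable.prodMk ?_ ?_
      · exact measurable_pi_lambda _ fun i => (measurable_pi_apply _).comp measurable_fst
      · exact measurable_pi_lambda _ fun i => (measurable_pi_apply _).comp measurable_snd
    have hind : IndepFun past (ε τ) P :=
      ((hε_indep τ).comp measurable_id hsel).symm
    have hmap := hind.map_prod_eq_prod_map_map hpast.aemeasurable (hε τ).aemeasurable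
    let f : ((Fin (n + 1) → X) × (Fin n → ℝ)) × ℝ → ENNReal := fun p =>
      ENNReal.ofReal (evidenceRatio k nu p.1.1 (Fin.snoc p.1.2 p.2))
    have hsnoc : Measurable fun p : ((Fin (n + 1) → X) × (Fin n → ℝ)) × ℝ =>
        (Fin.snoc p.1.2 p.2 : Fin (n + 1) → ℝ) := by
      refine measurable_pi_lambda _ fun i => ?_
      refine Fin.lastCases ?_ (fun i => ?_) i
      · simpa using measurable_snd
      · simp only [Fin.snoc_castSucc]
        fun_prop
    have hf : Measurable f :=
      ((measurable_evidenceRatio hk_cont nu (n + 1)).comp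
        ((measurable_fst.comp measurable_fst).prodMk hsnoc)).ennreal_ofReal
    have hεP : IsProbabilityMeasure (P.map (ε τ)) :=
      Measure.isProbabilityMeasure_map (hε τ).aemeasurable
    have hstep : ∀ p, ∫⁻ t, f (p, t) ∂(P.map (ε τ)) ≤
        ENNReal.ofReal (evidenceRatio k nu (p.1 ∘ Fin.castSucc) p.2) := by
      intro p
      obtain ⟨μ, s, hs, hμs⟩ := exists_evidenceRatio_snoc hk hnu p.1 p.2
      have hnonneg : 0 ≤ evidenceRatio k nu (p.1 ∘ Fin.castSucc) p.2 := by
        rw [evidenceRatio]; positivity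
      simp only [f, hμs, ENNReal.ofReal_mul hnonneg]
      rw [lintegral_const_mul _ (by fun_prop), lintegral_map (by fun_prop) (hε τ)]
      exact mul_le_of_le_one_right' (lintegral_exp_sub_sq_le_one (hε τ) (hε_subG τ) μ s hs)
    calc _ = ∫⁻ ω, f (past ω, ε τ ω) ∂P := by
          refine lintegral_congr fun ω => ?_
          simp only [f, past]
          congr 2
          funext i
          refine Fin.lastCases ?_ (fun i => ?_) i
          · rw [Fin.snoc_last]; rfl
          · rw [Fin.snoc_castSucc]; rfl
      _ = ∫⁻ p, f p ∂((P.map past).prod (P.map (ε τ))) := by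
          rw [← hmap, lintegral_map hf (hpast.prodMk (hε τ))]
      _ = ∫⁻ p, ∫⁻ t, f (p, t) ∂(P.map (ε τ)) ∂(P.map past) :=
          lintegral_prod _ hf.aemeasurable
      _ = ∫⁻ ω, ∫⁻ t, f (past ω, t) ∂(P.map (ε τ)) ∂P :=
          lintegral_map hf.lintegral_prod_right' hpast
      _ ≤ ∫⁻ ω, ENNReal.ofReal (evidenceRatio k nu ((past ω).1 ∘ Fin.castSucc) (past ω).2) ∂P :=
          lintegral_mono fun ω => hstep _
      _ ≤ 1 := ih hn'

end Evidence

end KernelRidge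

namespace KernelRidge

/-! ### Deterministic error bound for kernel ridge regression -/

section Ridge

lemma weightedNorm_sub_comm {E : Type*} [NormedAddCommGroup E] [InnerProductSpace ℝ E]
    (L : E →L[ℝ] E) (v w : E) :
    weightedNorm L (v - w) = weightedNorm L (w - v) := by
  rw [weightedNorm, weightedNorm, ← neg_sub, map_neg, inner_neg_neg]

open Matrix

variable {X E : Type*} [NormedAddCommGroup E] [InnerProductSpace ℝ E] [CompleteSpace E]
  [RKHS ℝ E X ℝ]

lemma inner_feature_feature (x y : X) :
    inner ℝ (feature E x) (feature E y) = reproducingKernel E x y := by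
  have h := RKHS.kernel_inner E x y (1 : ℝ) (1 : ℝ)
  rw [real_inner_comm, feature, feature, ← h, reproducingKernel]
  simp

lemma reproducingKernel_comm (x y : X) :
    reproducingKernel E x y = reproducingKernel E y x := by
  rw [← inner_feature_feature, real_inner_comm, inner_feature_feature]

lemma posSemidef_gramMatrix (n : ℕ) (z : Fin n → X) :
    (gramMatrix (reproducingKernel E) z).PosSemidef := by
  refine PosSemidef.of_dotProduct_mulVec_nonneg ?_ fun x => ?_
  · ext i j
    simp only [conjTranspose_apply, gramMatrix, of_apply, star_trivial]
    exact reproducingKernel_comm _ _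
  · have h : star x ⬝ᵥ gramMatrix (reproducingKernel E) z *ᵥ x =
        inner ℝ (∑ i, x i • feature E (z i)) (∑ j, x j • feature E (z j)) := by
      simp only [sum_inner, inner_sum, real_inner_smul_left, real_inner_smul_right, mulVec,
        dotProduct, gramMatrix, of_apply, star_trivial, inner_feature_feature, Finset.mul_sum]
      refine Finset.sum_congr rfl fun i _ => Finset.sum_congr rfl fun j _ => ?_
      rw [reproducingKernel_comm (z j) (z i)]
      ring
    rw [h]
    exact real_inner_self_nonneg

variable {N : ℕ}

lemma inner_covOp (z : Fin N → X) (nu : ℝ) (v w : E) :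
    inner ℝ v (covOp E z nu w) =
      ∑ τ, inner ℝ (feature E (z τ)) v * inner ℝ (feature E (z τ)) w + nu * inner ℝ v w := by
  simp only [covOp, _root_.add_apply, _root_.sum_apply,
    InnerProductSpace.rankOne_apply, _root_.smul_apply,
    ContinuousLinearMap.id_apply, inner_add_right, inner_sum, real_inner_smul_right]
  congr 1
  refine Finset.sum_congr rfl fun τ _ => ?_
  rw [real_inner_comm v, mul_comm]

lemma inner_covOp_self_nonneg (z : Fin N → X) {nu : ℝ} (hnu : 0 ≤ nu) (v : E) :
    0 ≤ inner ℝ v (covOp E z nu v) := by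
  rw [inner_covOp]
  exact add_nonneg (Finset.sum_nonneg fun _ _ => mul_self_nonneg _)
    (mul_nonneg hnu real_inner_self_nonneg)

lemma inner_covOp_comm (z : Fin N → X) (nu : ℝ) (v w : E) :
    inner ℝ v (covOp E z nu w) = inner ℝ w (covOp E z nu v) := by
  rw [inner_covOp, inner_covOp, real_inner_comm]
  simp_rw [mul_comm]

lemma inner_covOp_le (z : Fin N → X) {nu : ℝ} (hnu : 0 ≤ nu) (v w : E) :
    inner ℝ v (covOp E z nu w) ≤
      weightedNorm (covOp E z nu) v * weightedNorm (covOp E z nu) w := by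
  -- Cauchy–Schwarz for the form of Λ: the quadratic `t ↦ ‖v + t w‖_Λ²` is nonnegative.
  have h := discrim_le_zero (a := inner ℝ w (covOp E z nu w))
    (b := 2 * inner ℝ v (covOp E z nu w)) (c := inner ℝ v (covOp E z nu v)) fun t => by
      have h0 := inner_covOp_self_nonneg z hnu (v + t • w)
      simp only [map_add, map_smul, inner_add_left, inner_add_right, real_inner_smul_left,
        real_inner_smul_right] at h0
      rw [inner_covOp_comm z nu w v] at h0
      linarith
  rw [discrim] at h
  rw [weightedNorm, weightedNorm, ← Real.sqrt_mul (inner_covOp_self_nonneg z hnu v)]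
  refine Real.le_sqrt_of_sq_le ?_
  linarith

lemma sqrt_mul_norm_le_weightedNorm (z : Fin N → X) {nu : ℝ} (hnu : 0 ≤ nu) (v : E) :
    Real.sqrt nu * ‖v‖ ≤ weightedNorm (covOp E z nu) v := by
  refine Real.le_sqrt_of_sq_le ?_
  rw [mul_pow, Real.sq_sqrt hnu, inner_covOp, ← real_inner_self_eq_norm_sq]
  have : 0 ≤ ∑ τ, inner ℝ (feature E (z τ)) v * inner ℝ (feature E (z τ)) v :=
    Finset.sum_nonneg fun _ _ => mul_self_nonneg _
  linarith

/-- The normal equation of kernel ridge regression. -/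
lemma inner_covOp_of_isMinOn {z : Fin N → X} {y : Fin N → ℝ} {nu : ℝ} {θ : E}
    (h : IsMinOn (ridgeObjective z y nu) Set.univ θ) (v : E) :
    inner ℝ v (covOp E z nu θ) = ∑ τ, y τ * inner ℝ (feature E (z τ)) v := by
  -- Minimality along the line `θ + t v` gives a nonnegative quadratic in `t` without constant term,
  -- so its linear coefficient vanishes.
  have key := discrim_le_zero
    (a := ∑ τ, inner ℝ (feature E (z τ)) v ^ 2 + nu * inner ℝ v v)
    (b := 2 * (inner ℝ v (covOp E z nu θ) - ∑ τ, y τ * inner ℝ (feature E (z τ)) v))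
    (c := 0) fun t => by
      have h0 := h (Set.mem_univ (θ + t • v))
      simp only [Set.mem_ofPred_eq, ridgeObjective, ← real_inner_self_eq_norm_sq, inner_add_left,
        inner_add_right, real_inner_smul_left, real_inner_smul_right] at h0
      have hexp : ∑ τ, (y τ - (inner ℝ (feature E (z τ)) θ + t * inner ℝ (feature E (z τ)) v)) ^ 2
          = ∑ τ, (y τ - inner ℝ (feature E (z τ)) θ) ^ 2
            + 2 * t * (∑ τ, inner ℝ (feature E (z τ)) v * inner ℝ (feature E (z τ)) θ
              - ∑ τ, y τ * inner ℝ (feature E (z τ)) v)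
            + t * t * ∑ τ, inner ℝ (feature E (z τ)) v ^ 2 := by
        rw [← Finset.sum_sub_distrib, Finset.mul_sum, Finset.mul_sum, ← Finset.sum_add_distrib,
          ← Finset.sum_add_distrib]
        refine Finset.sum_congr rfl fun τ _ => ?_
        ring
      rw [hexp, real_inner_comm v θ] at h0
      rw [inner_covOp]
      linarith
  rw [discrim, mul_zero, sub_zero] at key
  have := pow_eq_zero_iff (two_ne_zero) |>.1 (le_antisymm key (sq_nonneg _))
  linarith

lemma weightedNorm_sub_le {z : Fin N → X} {e : Fin N → ℝ} {nu : ℝ} (hnu : 1 ≤ nu)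
    {θ θ₀ : E} {y : Fin N → ℝ}
    (hy : ∀ τ, y τ = inner ℝ θ₀ (feature E (z τ)) + e τ)
    (h : IsMinOn (ridgeObjective z y nu) Set.univ θ) :
    weightedNorm (covOp E z nu) (θ - θ₀) ≤ Real.sqrt nu * ‖θ₀‖ +
      Real.sqrt (e ⬝ᵥ e - e ⬝ᵥ (regGram (reproducingKernel E) nu z)⁻¹ *ᵥ e) := by
  have hnu0 : 0 < nu := by linarith
  set A := regGram (reproducingKernel E) nu z with hA
  have hApos : A.PosDef := posDef_regGram posSemidef_gramMatrix hnu0 z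
  set c := A⁻¹ *ᵥ e with hc
  have hAc : A *ᵥ c = e := by
    rw [hc, mulVec_mulVec, mul_nonsing_inv _ (isUnit_iff_ne_zero.2 hApos.det_pos.ne'), one_mulVec]
  -- The solution of Λ a = ∑ e_τ φ(z_τ), obtained in the span of the features from `A c = e`.
  set a : E := ∑ i, c i • feature E (z i) with ha
  set d : E := θ - θ₀ with hd
  have hφa : ∀ τ, inner ℝ (feature E (z τ)) a = e τ - nu * c τ := fun τ => by
    have h1 := congrFun hAc τ
    rw [hA, regGram, add_mulVec, smul_mulVec, one_mulVec] at h1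
    simp only [Pi.add_apply, Pi.smul_apply, smul_eq_mul] at h1
    rw [← h1, ha, inner_sum]
    simp only [real_inner_smul_right, inner_feature_feature, mulVec, dotProduct, gramMatrix,
      of_apply]
    simp_rw [mul_comm]
    ring
  have hBa : ∀ v, inner ℝ v (covOp E z nu a) = ∑ τ, e τ * inner ℝ (feature E (z τ)) v := by
    intro v
    rw [inner_covOp]
    simp only [hφa]
    rw [ha, inner_sum, Finset.mul_sum, ← Finset.sum_add_distrib]
    refine Finset.sum_congr rfl fun τ _ => ?_
    rw [real_inner_smul_right, real_inner_comm v]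
    ring
  have hBd : inner ℝ d (covOp E z nu d) = inner ℝ d (covOp E z nu a) - nu * inner ℝ θ₀ d := by
    have h1 := inner_covOp_of_isMinOn h d
    rw [hBa, show covOp E z nu d = covOp E z nu θ - covOp E z nu θ₀ by rw [hd, map_sub],
      inner_sub_right, h1, inner_covOp, real_inner_comm d θ₀]
    have h2 : ∑ τ, y τ * inner ℝ (feature E (z τ)) d =
        ∑ τ, inner ℝ (feature E (z τ)) d * inner ℝ (feature E (z τ)) θ₀ +
          ∑ τ, e τ * inner ℝ (feature E (z τ)) d := by
      rw [← Finset.sum_add_distrib]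
      refine Finset.sum_congr rfl fun τ _ => ?_
      rw [hy, real_inner_comm (feature E (z τ)) θ₀]
      ring
    rw [h2]
    ring
  have hna : weightedNorm (covOp E z nu) a ≤ Real.sqrt (e ⬝ᵥ e - e ⬝ᵥ c) := by
    refine Real.sqrt_le_sqrt ?_
    rw [hBa]
    have h1 : ∑ τ, e τ * inner ℝ (feature E (z τ)) a = e ⬝ᵥ e - nu * (e ⬝ᵥ c) := by
      simp only [hφa, dotProduct, Finset.mul_sum, ← Finset.sum_sub_distrib]
      refine Finset.sum_congr rfl fun τ _ => ?_
      ring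
    -- With `nu ≥ 1`, this sign allows `nu * (e ⬝ᵥ c)` to be replaced by `e ⬝ᵥ c`.
    have h2 : 0 ≤ e ⬝ᵥ c := by
      simpa [hc] using hApos.inv.posSemidef.dotProduct_mulVec_nonneg e
    rw [h1]
    nlinarith
  have hwd : weightedNorm (covOp E z nu) d ^ 2 = inner ℝ d (covOp E z nu d) :=
    Real.sq_sqrt (inner_covOp_self_nonneg z hnu0.le d)
  have hw0 : 0 ≤ weightedNorm (covOp E z nu) d := Real.sqrt_nonneg _
  have hCS := inner_covOp_le z hnu0.le d a
  have hθ : -(nu * inner ℝ θ₀ d) ≤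
      Real.sqrt nu * ‖θ₀‖ * weightedNorm (covOp E z nu) d := by
    have h1 := (abs_le.1 (abs_real_inner_le_norm θ₀ d)).1
    have h2 := sqrt_mul_norm_le_weightedNorm z hnu0.le d
    calc -(nu * inner ℝ θ₀ d) ≤ nu * (‖θ₀‖ * ‖d‖) := by nlinarith
      _ = Real.sqrt nu * ‖θ₀‖ * (Real.sqrt nu * ‖d‖) := by
        nth_rewrite 1 [← Real.mul_self_sqrt hnu0.le]; ring
      _ ≤ _ := by gcongr
  rcases hw0.eq_or_lt with h0 | h0
  · rw [← h0]; positivity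
  · have h1 : weightedNorm (covOp E z nu) d * weightedNorm (covOp E z nu) d ≤
        weightedNorm (covOp E z nu) d *
          (Real.sqrt nu * ‖θ₀‖ + Real.sqrt (e ⬝ᵥ e - e ⬝ᵥ c)) := by
      have := mul_le_mul_of_nonneg_left hna hw0
      nlinarith
    exact le_of_mul_le_mul_left h1 h0

lemma weightedNorm_sub_le_radius {z : Fin N → X} {e : Fin N → ℝ} {nu S δ : ℝ} (hnu : 1 ≤ nu)
    (hδ : 0 < δ) {θ θ₀ : E} (hS : ‖θ₀‖ ≤ S) {y : Fin N → ℝ}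
    (hy : ∀ τ, y τ = inner ℝ θ₀ (feature E (z τ)) + e τ)
    (h : IsMinOn (ridgeObjective z y nu) Set.univ θ)
    (hev : evidenceRatio (reproducingKernel E) nu z e ≤ 1 / δ) :
    weightedNorm (covOp E z nu) (θ - θ₀) ≤ radius (reproducingKernel E) z nu S δ := by
  refine (weightedNorm_sub_le hnu hy h).trans ?_
  have hdet := (posDef_regGram (k := reproducingKernel E) posSemidef_gramMatrix
    (by linarith : 0 < nu) z).det_pos
  rw [radius]
  refine add_le_add (by gcongr) (Real.sqrt_le_sqrt ?_)
  change _ ≤ Real.log ((regGram (reproducingKernel E) nu z).det / δ ^ 2)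
  rw [evidenceRatio, div_le_div_iff₀ (Real.sqrt_pos.2 hdet) hδ, one_mul] at hev
  rw [Real.le_log_iff_exp_le (by positivity), le_div_iff₀ (by positivity)]
  have h2 := pow_le_pow_left₀ (by positivity) hev 2
  rw [mul_pow, Real.sq_sqrt hdet.le, ← Real.exp_nat_mul] at h2
  convert! h2 using 3
  push_cast
  ring

end Ridge

/-! ### Comparison with the maximum information gain -/

section InformationGain

open Matrix

lemma log_det_le_trace_sub_card {n : ℕ} {A : Matrix (Fin n) (Fin n) ℝ} (hA : A.PosDef) :
    Real.log A.det ≤ A.trace - n := by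
  have hdet : A.det = ∏ i, hA.isHermitian.eigenvalues i := by
    simpa using hA.isHermitian.det_eq_prod_eigenvalues
  have htr : A.trace = ∑ i, hA.isHermitian.eigenvalues i := by
    simpa using hA.isHermitian.trace_eq_sum_eigenvalues
  rw [hdet, htr, Real.log_prod fun i _ => (hA.eigenvalues_pos i).ne']
  calc _ ≤ ∑ i, (hA.isHermitian.eigenvalues i - 1) :=
        Finset.sum_le_sum fun i _ => Real.log_le_sub_one_of_pos (hA.eigenvalues_pos i)
    _ = _ := by simp [Finset.sum_sub_distrib]

variable {X : Type*} {k : X → X → ℝ}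

lemma log_det_le_two_mul_maxInfoGain
    (hk : ∀ (n : ℕ) (z : Fin n → X), (gramMatrix k z).PosSemidef) (hk_le : ∀ x, k x x ≤ 1)
    {lam : ℝ} (hlam : 0 < lam) {N : ℕ} (z : Fin N → X) :
    Real.log (1 + lam⁻¹ • gramMatrix k z).det ≤ 2 * maxInfoGain k N lam := by
  -- Without boundedness `sSup` would take its default value 0. Here log det(I + K/lam) ≤ tr K / lam
  -- ≤ N / lam, as `k x x ≤ 1`.
  have hbdd : BddAbove {g : ℝ | ∃ l : ℕ, l ≤ N ∧ ∃ z : Fin l → X,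
      g = (1 / 2) * Real.log (1 + lam⁻¹ • gramMatrix k z).det} := by
    refine ⟨(1 / 2) * (lam⁻¹ * N), ?_⟩
    rintro _ ⟨l, hl, z, rfl⟩
    refine mul_le_mul_of_nonneg_left ?_ (by norm_num)
    refine (log_det_le_trace_sub_card
      (PosDef.one.add_posSemidef ((hk l z).smul (inv_nonneg.2 hlam.le)))).trans ?_
    rw [trace_add, trace_one, trace_smul, Fintype.card_fin, add_sub_cancel_left, smul_eq_mul]
    have : (gramMatrix k z).trace ≤ N := by
      calc (gramMatrix k z).trace ≤ ∑ _i : Fin l, (1 : ℝ) :=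
            Finset.sum_le_sum fun i _ => hk_le (z i)
        _ = l := by simp
        _ ≤ N := by exact_mod_cast hl
    gcongr
  have := le_csSup hbdd ⟨N, le_rfl, z, rfl⟩
  rw [maxInfoGain]
  linarith

lemma radius_le_gainRadius
    (hk : ∀ (n : ℕ) (z : Fin n → X), (gramMatrix k z).PosSemidef) (hk_le : ∀ x, k x x ≤ 1)
    {N : ℕ} (hN : 0 < N) {nu S δ : ℝ} (hnu : nu = 1 + 1 / (N : ℝ)) (hδ : 0 < δ)
    (z : Fin N → X) : radius k z nu S δ ≤ gainRadius k N nu S δ := by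
  have hN' : (0 : ℝ) < N := by exact_mod_cast hN
  have hnu0 : 0 < nu := by rw [hnu]; positivity
  refine add_le_add le_rfl (Real.sqrt_le_sqrt ?_)
  have hfac : (nu • (1 : Matrix (Fin N) (Fin N) ℝ) + gramMatrix k z).det =
      nu ^ N * (1 + nu⁻¹ • gramMatrix k z).det := by
    have h : nu • (1 : Matrix (Fin N) (Fin N) ℝ) + gramMatrix k z =
        nu • (1 + nu⁻¹ • gramMatrix k z) := by
      rw [smul_add, smul_smul, mul_inv_cancel₀ hnu0.ne', one_smul]
    rw [h, det_smul, Fintype.card_fin]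
  have hpos : 0 < (1 + nu⁻¹ • gramMatrix k z).det :=
    (PosDef.one.add_posSemidef ((hk N z).smul (inv_nonneg.2 hnu0.le))).det_pos
  have hlog : N * Real.log nu ≤ 1 := by
    have h := Real.log_le_sub_one_of_pos hnu0
    calc N * Real.log nu ≤ N * (nu - 1) := by gcongr
      _ = 1 := by rw [hnu]; field_simp; ring
  have hgain := log_det_le_two_mul_maxInfoGain hk hk_le hnu0 z
  rw [hfac, div_eq_mul_one_div, Real.log_mul (by positivity) (by positivity),
    Real.log_mul (by positivity) hpos.ne', Real.log_pow]
  linarith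

end InformationGain

/-! ### Markov's inequality and the confidence event -/

section Probability

lemma one_sub_le_measureReal_of_lintegral_le_one {Ω : Type*} [MeasurableSpace Ω]
    {P : Measure Ω} [IsProbabilityMeasure P] {f : Ω → ℝ} (hf : Measurable f)
    (hint : ∫⁻ ω, ENNReal.ofReal (f ω) ∂P ≤ 1) {δ : ℝ} (hδ : 0 < δ) :
    1 - δ ≤ P.real {ω | f ω ≤ 1 / δ} := by
  have hmeas : MeasurableSet {ω | f ω ≤ 1 / δ} := measurableSet_le hf measurable_const
  have hle : P {ω | f ω ≤ 1 / δ}ᶜ ≤ ENNReal.ofReal δ := by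
    calc P {ω | f ω ≤ 1 / δ}ᶜ ≤ P {ω | ENNReal.ofReal (1 / δ) ≤ ENNReal.ofReal (f ω)} := by
          refine measure_mono fun ω hω => ?_
          exact ENNReal.ofReal_le_ofReal (lt_of_not_ge fun h => hω h).le
      _ ≤ (∫⁻ ω, ENNReal.ofReal (f ω) ∂P) / ENNReal.ofReal (1 / δ) :=
          meas_ge_le_lintegral_div hf.ennreal_ofReal.aemeasurable
            (by simpa using hδ) ENNReal.ofReal_ne_top
      _ ≤ 1 / ENNReal.ofReal (1 / δ) := by gcongr
      _ = ENNReal.ofReal δ := by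
          rw [one_div δ, ENNReal.ofReal_inv_of_pos hδ, one_div, inv_inv]
  have h := probReal_compl_eq_one_sub (μ := P) hmeas
  have h2 : P.real {ω | f ω ≤ 1 / δ}ᶜ ≤ δ := ENNReal.toReal_le_of_le_ofReal hδ.le hle
  linarith

lemma one_sub_le_measureReal_evidenceRatio_le {X : Type*} [TopologicalSpace X]
    [SecondCountableTopology X] [MeasurableSpace X] [BorelSpace X] {k : X → X → ℝ}
    (hk_cont : Continuous fun p : X × X => k p.1 p.2)
    (hk : ∀ (n : ℕ) (z : Fin n → X), (gramMatrix k z).PosSemidef) {nu : ℝ} (hnu : 1 ≤ nu)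
    {Ω : Type*} [MeasurableSpace Ω] {P : Measure Ω} [IsProbabilityMeasure P] {N : ℕ}
    {z : Fin N → Ω → X} (hz : ∀ τ, Measurable (z τ))
    {ε : Fin N → Ω → ℝ} (hε : ∀ τ, Measurable (ε τ))
    (hε_subG : ∀ τ, HasSubgaussianMGF (ε τ) 1 P)
    (hε_indep : ∀ τ, IndepFun (ε τ)
      (fun ω => ((fun i : Set.Iic τ => z i ω), (fun i : Set.Iio τ => ε i ω))) P)
    {δ : ℝ} (hδ : 0 < δ) :
    1 - δ ≤ P.real {ω | evidenceRatio k nu (fun τ => z τ ω) (fun τ => ε τ ω) ≤ 1 / δ} := by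
  have hpair : Measurable fun ω => ((fun τ => z τ ω), (fun τ => ε τ ω)) :=
    (measurable_pi_lambda _ hz).prodMk (measurable_pi_lambda _ hε)
  have hint := lintegral_evidenceRatio_le_one hk_cont hk hnu hz hε hε_subG hε_indep N le_rfl
  simp only [Fin.castLE_rfl, id_eq] at hint
  exact one_sub_le_measureReal_of_lintegral_le_one
    ((measurable_evidenceRatio hk_cont nu N).comp hpair) hint hδ

end Probability

end KernelRidge

theorem mainTheorem2
    -- the compact set of state-action pairs, and an RKHS `E` on it with kernel `k`
    {m : ℕ} (Z : Set (EuclideanSpace ℝ (Fin m))) (hZ : IsCompact Z)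
    {E : Type*} [NormedAddCommGroup E] [InnerProductSpace ℝ E] [CompleteSpace E]
    [RKHS ℝ E Z ℝ]
    (k : Z → Z → ℝ) (hk : k = KernelRidge.reproducingKernel E)
    (hk_cont : Continuous fun p : Z × Z => k p.1 p.2)
    (hk_le : ∀ x, k x x ≤ 1)
    -- the labeled data: `N` trajectories of length `H`
    {Ω : Type*} [MeasurableSpace Ω] (P : Measure Ω) [IsProbabilityMeasure P]
    {H N : ℕ}
    (z : Fin H → Fin N → Ω → Z) (hz : ∀ h τ, Measurable (z h τ))
    (ε : Fin H → Fin N → Ω → ℝ) (hε : ∀ h τ, Measurable (ε h τ))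
    (r : Fin H → Fin N → Ω → ℝ)
    (θstar : Fin H → E)
    (hr : ∀ h τ ω, r h τ ω = inner ℝ (θstar h) (KernelRidge.feature E (z h τ ω)) + ε h τ ω)
    -- the noise is centered, `1`-sub-Gaussian, and `ε h τ` is independent of the
    -- state-action pairs up to trajectory `τ` and of the noise of the earlier trajectories
    (hε_mean : ∀ h τ, ∫ ω, ε h τ ω ∂P = 0)
    (hε_subG : ∀ h τ, HasSubgaussianMGF (ε h τ) 1 P)
    (hε_indep : ∀ h τ, IndepFun (ε h τ)
      (fun ω => ((fun i : Set.Iic τ => z h i ω), (fun i : Set.Iio τ => ε h i ω))) P)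
    -- the norm bound, the regularization parameter and the confidence level
    (S : ℝ) (hS : ∀ h, ‖θstar h‖ ≤ S)
    (nu : ℝ) (hnu : 1 ≤ nu)
    (δ : ℝ) (hδ : δ ∈ Set.Ioo (0 : ℝ) 1)
    -- the kernel ridge regression estimate
    (θhat : Fin H → Ω → E)
    (hθhat : ∀ h ω, IsMinOn
      (KernelRidge.ridgeObjective (fun τ => z h τ ω) (fun τ => r h τ ω) nu) Set.univ (θhat h ω))
    (h : Fin H) :
    1 - δ ≤ P.real {ω |
        KernelRidge.weightedNorm (KernelRidge.covOp E (fun τ => z h τ ω) nu)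
          (θhat h ω - θstar h) ≤ KernelRidge.radius k (fun τ => z h τ ω) nu S δ} ∧
    1 - δ ≤ P.real {ω |
        θstar h ∈ KernelRidge.ellipsoid (KernelRidge.covOp E (fun τ => z h τ ω) nu)
          (θhat h ω) (KernelRidge.radius k (fun τ => z h τ ω) nu S δ)} ∧
    (0 < N → nu = 1 + 1 / (N : ℝ) →
      (∀ ω, KernelRidge.radius k (fun τ => z h τ ω) nu S δ
        ≤ KernelRidge.gainRadius k N nu S δ) ∧
      1 - δ ≤ P.real {ω |
        KernelRidge.weightedNorm (KernelRidge.covOp E (fun τ => z h τ ω) nu)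
          (θhat h ω - θstar h) ≤ KernelRidge.gainRadius k N nu S δ} ∧
      1 - δ ≤ P.real {ω |
        θstar h ∈ KernelRidge.ellipsoid (KernelRidge.covOp E (fun τ => z h τ ω) nu)
          (θhat h ω) (KernelRidge.gainRadius k N nu S δ)}) := by
  subst hk
  have hpsd := KernelRidge.posSemidef_gramMatrix (E := E)
  have hprob := KernelRidge.one_sub_le_measureReal_evidenceRatio_le hk_cont hpsd hnu (hz h) (hε h)
    (hε_subG h) (hε_indep h) hδ.1
  have hsub : ∀ ω, KernelRidge.evidenceRatio (KernelRidge.reproducingKernel E) nu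
      (fun τ => z h τ ω) (fun τ => ε h τ ω) ≤ 1 / δ →
      KernelRidge.weightedNorm (KernelRidge.covOp E (fun τ => z h τ ω) nu)
        (θhat h ω - θstar h) ≤
          KernelRidge.radius (KernelRidge.reproducingKernel E) (fun τ => z h τ ω) nu S δ :=
    fun ω hω => KernelRidge.weightedNorm_sub_le_radius hnu hδ.1 (hS h) (fun τ => hr h τ ω)
      (hθhat h ω) hω
  have hrad : 0 < N → nu = 1 + 1 / (N : ℝ) → ∀ ω,
      KernelRidge.radius (KernelRidge.reproducingKernel E) (fun τ => z h τ ω) nu S δ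
        ≤ KernelRidge.gainRadius (KernelRidge.reproducingKernel E) N nu S δ := fun hN hnuN ω =>
    KernelRidge.radius_le_gainRadius hpsd hk_le hN hnuN hδ.1 _
  -- Only the evidence event needs to be measurable; monotonicity covers any event containing it, so
  -- no measurability of `θhat` is needed.
  have hmono : ∀ q : Ω → Prop, (∀ ω, KernelRidge.evidenceRatio (KernelRidge.reproducingKernel E) nu
      (fun τ => z h τ ω) (fun τ => ε h τ ω) ≤ 1 / δ → q ω) → 1 - δ ≤ P.real {ω | q ω} :=
    fun q hq => hprob.trans (measureReal_mono fun ω hω => hq ω hω)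
  have hell : ∀ ω R, KernelRidge.weightedNorm (KernelRidge.covOp E (fun τ => z h τ ω) nu)
        (θhat h ω - θstar h) ≤ R →
      θstar h ∈ KernelRidge.ellipsoid (KernelRidge.covOp E (fun τ => z h τ ω) nu)
        (θhat h ω) R := fun ω R hR => by
    rw [KernelRidge.ellipsoid, Set.mem_ofPred_eq, KernelRidge.weightedNorm_sub_comm]
    exact hR
  refine ⟨hmono _ hsub, hmono _ fun ω hω => hell ω _ (hsub ω hω),
    fun hN hnuN => ⟨hrad hN hnuN, hmono _ fun ω hω => (hsub ω hω).trans (hrad hN hnuN ω),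
      hmono _ fun ω hω => hell ω _ ((hsub ω hω).trans (hrad hN hnuN ω))⟩⟩
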